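/- Let $\mathfrak F\subset\mathbb C$ be a non-empty closed set and let $f:\mathfrak F\to\mathbb C$ be an arbitrary function. The function $f$ is called commutator Lipschitz, $f\in\mathrm{CL}(\mathfrak F)$, if it is continuous and there is a constant $C\ge 0$ such that $$\|f(N)R-Rf(N)\|\le C\,\|NR-RN\|$$ for every complex Hilbert space $\mathcal H$, every bounded normal operator $N$ on $\mathcal H$ with $\sigma(N)\subset\mathfrak F$ and every bounded operator $R$ on $\mathcal H$. The least such $C$ is denoted by $\|f\|_{\mathrm{CL}(\mathfrak F)}$, and $\|f\|_{\mathrm{CL}(\mathfrak F)}=\infty$ if $f\notin\mathrm{CL}(\mathfrak F)$. Let $\mathfrak D_0f:\mathfrak F\times\mathfrak F\to\mathbb C$ be defined by $(\mathfrak D_0f)(z,w)=\frac{f(z)-f(w)}{z-w}$ for $z\ne w$ and $(\mathfrak D_0f)(z,z)=0$. Let $\mathcal B(\mathfrak F\times\mathfrak F)$ be the set of matrices $A=\{a(s,t)\}_{s,t\in\mathfrak F}$ that define a bounded operator on $\ell^2(\mathfrak F)$ (where $\mathfrak F$ is regarded as a discrete, possibly uncountable index set), by $(Ax)_s=\sum_{t}a(s,t)x_t$;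 $\|A\|$ is the norm of this operator, and $\|A\|=\infty$ if $A\notin\mathcal B(\mathfrak F\times\mathfrak F)$. For a matrix $\Phi=\{\Phi(s,t)\}_{s,t\in\mathfrak F}$ put $\Phi\star A=\{\Phi(s,t)a(s,t)\}$. The matrix $\Phi$ is a Schur multiplier, $\Phi\in\mathfrak M(\mathfrak F\times\mathfrak F)$, if $\Phi\star A\in\mathcal B(\mathfrak F\times\mathfrak F)$ for all $A\in\mathcal B(\mathfrak F\times\mathfrak F)$. Put $$\|\Phi\|_{\mathfrak M(\mathfrak F\times\mathfrak F)}=\sup\{\|\Phi\star A\|:\ \|A\|\le 1\},$$ $$\|\Phi\|_{\mathfrak M_0(\mathfrak F\times\mathfrak F)}=\sup\{\|\Phi\star A\|:\ \|A\|\le 1,\ a(t,t)=0\text{ for all }t\in\mathfrak F\}.$$ Theorem. $f\in\mathrm{CL}(\mathfrak F)$ if and only if $\mathfrak D_0f\in\mathfrak M(\mathfrak F\times\mathfrak F)$. Moreover, as an (in)equality of elements of $[0,\infty]$, $$\|f\|_{\mathrm{CL}(\mathfrak F)}=\|\mathfrak D_0f\|_{\mathfrak M_0(\mathfrak F\times\mathfrak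 F)}\le\|\mathfrak D_0f\|_{\mathfrak M(\mathfrak F\times\mathfrak F)}\le 2\,\|f\|_{\mathrm{CL}(\mathfrak F)}.$$ -/

import Mathlib

open scoped NNReal ENNReal

universe u

noncomputable section

namespace CommutatorLipschitz

/-! ### Discrete Schur multipliers -/

/-- The matrix `a`, with rows indexed by `S` and columns by `T`, is the matrix of the bounded
operator `A : ℓ²(T) → ℓ²(S)`, i.e. `(A x)_s = ∑ t, a s t * x t` for all `x` and `s`. -/
def IsMatrixOf {S T : Type*} (a : S → T → ℂ)
    (A : lp (fun _ : T => ℂ) 2 →L[ℂ] lp (fun _ : S => ℂ) 2) : Prop :=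
  ∀ (x : lp (fun _ : T => ℂ) 2) (s : S), HasSum (fun t : T => a s t * x t) (A x s)

/-- The matrix `a` belongs to `𝓑(S × T)`: it defines a bounded operator `ℓ²(T) → ℓ²(S)`. -/
def IsBoundedMatrix {S T : Type*} (a : S → T → ℂ) : Prop :=
  ∃ A : lp (fun _ : T => ℂ) 2 →L[ℂ] lp (fun _ : S => ℂ) 2, IsMatrixOf a A

/-- The operator norm of a matrix: the norm of the (unique) bounded operator that it defines,
and `∞` if it does not define a bounded operator. -/
def matrixNorm {S T : Type*} (a : S → T → ℂ) : ℝ≥0∞ :=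
  ⨅ (A : lp (fun _ : T => ℂ) 2 →L[ℂ] lp (fun _ : S => ℂ) 2) (_ : IsMatrixOf a A), ‖A‖ₑ

/-- The Schur (entrywise) product of two matrices. -/
def schurMul {S T : Type*} (Φ a : S → T → ℂ) : S → T → ℂ :=
  fun s t => Φ s t * a s t

/-- `Φ ∈ 𝔐(S × T)`: Schur multiplication by `Φ` maps `𝓑(S × T)` to itself. -/
def IsSchurMultiplier {S T : Type*} (Φ : S → T → ℂ) : Prop :=
  ∀ a : S → T → ℂ, IsBoundedMatrix a → IsBoundedMatrix (schurMul Φ a)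

/-- `‖Φ‖_𝔐 = sup {‖Φ ⋆ a‖ : ‖a‖ ≤ 1}`. -/
def schurNorm {S T : Type*} (Φ : S → T → ℂ) : ℝ≥0∞ :=
  ⨆ (a : S → T → ℂ) (_ : matrixNorm a ≤ 1), matrixNorm (schurMul Φ a)

/-- `‖Φ‖_𝔐₀ = sup {‖Φ ⋆ a‖ : ‖a‖ ≤ 1, a t t = 0 for all t ∈ S ∩ T}`, where `S` and `T` are subsets
of a common set `X`. -/
def schurNormZero {X : Type*} {S T : Set X} (Φ : S → T → ℂ) : ℝ≥0∞ :=
  ⨆ (a : S → T → ℂ) (_ : matrixNorm a ≤ 1)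
    (_ : ∀ (s : S) (t : T), (s : X) = (t : X) → a s t = 0), matrixNorm (schurMul Φ a)

/-! ### Divided differences and commutator Lipschitz functions -/

open Classical in
/-- The divided difference `𝔇₀ f` on `F × F`, equal to `0` on the diagonal. -/
def dividedDiff {F : Set ℂ} (f : F → ℂ) : F → F → ℂ :=
  fun z w => if z = w then 0 else (f z - f w) / ((z : ℂ) - (w : ℂ))

/-- The function `f` is continuous on `F` and
`‖f(N) R - R f(N)‖ ≤ C ‖N R - R N‖` for all complex Hilbert spaces `H`, all bounded normal operators
`N` on `H` with spectrum in `F` and all bounded operators `R` on `H`. Here `f(N)` is given by the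
continuous functional calculus. -/
def IsCLConst {F : Set ℂ} (f : F → ℂ) (C : ℝ≥0) : Prop :=
  ∃ hf : Continuous f,
    ∀ (H : Type u) [NormedAddCommGroup H] [InnerProductSpace ℂ H] [CompleteSpace H]
      (N R : H →L[ℂ] H) (hN : IsStarNormal N) (hF : spectrum ℂ N ⊆ F),
      ‖cfcHomSuperset hN hF ⟨f, hf⟩ * R - R * cfcHomSuperset hN hF ⟨f, hf⟩‖
        ≤ C * ‖N * R - R * N‖

/-- `f ∈ CL(F)`: the function `f` is commutator Lipschitz on `F`. -/
def IsCommutatorLipschitz {F : Set ℂ} (f : F → ℂ) : Prop :=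
  ∃ C : ℝ≥0, IsCLConst.{u} f C

/-- `‖f‖_CL(F)`: the least admissible constant, and `∞` if `f ∉ CL(F)`. -/
def clNorm {F : Set ℂ} (f : F → ℂ) : ℝ≥0∞ :=
  ⨅ (C : ℝ≥0) (_ : IsCLConst.{u} f C), (C : ℝ≥0∞)

end CommutatorLipschitz

end

noncomputable section

namespace CommutatorLipschitz

/-! For a diagonal operator `N` with eigenvalues `λ_i`, the commutator `NR - RN` has entries `(λ_i -
λ_j) r_ij`, and `f(N)R - Rf(N)` is its Schur product with the divided difference. Commutators with
`N` have zero diagonal, which is why the zero-diagonal Schur norm appears.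

Lower bound (`schurNormZero_le_of_isCLConst`): the norm of a matrix is tested on finite index sets,
where any zero-diagonal matrix is the commutator of a diagonal `N` with some `R`.

Upper bound (`norm_commutator_le_of_schur`): a general normal `N` is almost diagonalised. Functions
`h_j` with `∑ h_j ^ 2 = 1`, each supported within `ε` of a point `j` of `F`, cut the space into
blocks on which `N` and `f(N)` are nearly the scalars `j` and `f j`. Vectors chosen in the blocks
turn the commutator into a scalar matrix of almost the same norm; the Schur bound applies to it, and
`ε → 0`.

The factor 2 is the cost of deleting the diagonal of a matrix, and finiteness of the Schur norm of a
multiplier is the closed graph theorem. -/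

/-- The bilinear form with matrix `a` is bounded by `C` on finitely supported vectors. -/
def FormBound {S T : Type*} (a : S → T → ℂ) (C : ℝ) : Prop :=
  ∀ (s : Finset S) (t : Finset T) (d : S → ℂ) (c : T → ℂ),
    ‖∑ i ∈ s, ∑ j ∈ t, d i * a i j * c j‖
      ≤ C * √(∑ i ∈ s, ‖d i‖ ^ 2) * √(∑ j ∈ t, ‖c j‖ ^ 2)

/-! ### Bounded matrices as bounded forms on finitely supported vectors. -/

/-- Closes duality arguments: testing a form against its own values bounds a sum of squares `X` by
`K * √X`. -/
theorem le_sq_of_le_mul_sqrt {X K : ℝ} (hX : 0 ≤ X) (hK : 0 ≤ K) (h : X ≤ K * √X) :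
    X ≤ K ^ 2 := by
  have h1 := Real.sq_sqrt hX
  have h2 := Real.sqrt_nonneg X
  rcases h2.eq_or_lt with h0 | h0
  · rw [← h0] at h1; nlinarith
  · have : √X ≤ K := by
      by_contra! hc
      nlinarith
    nlinarith

theorem memLp_two_of_sum_le {S : Type*} {y : S → ℂ} {K : ℝ}
    (h : ∀ s : Finset S, ∑ i ∈ s, ‖y i‖ ^ 2 ≤ K) : Memℓp y 2 :=
  memℓp_gen' (C := K) (fun s => by simpa using h s)

theorem lp_two_norm_le {S : Type*} (y : lp (fun _ : S => ℂ) 2) {K : ℝ} (hK : 0 ≤ K)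
    (h : ∀ s : Finset S, ∑ i ∈ s, ‖y i‖ ^ 2 ≤ K ^ 2) : ‖y‖ ≤ K := by
  refine lp.norm_le_of_forall_sum_le (by simp) hK (fun s => ?_)
  simpa using h s

theorem lp_two_sum_le {S : Type*} (y : lp (fun _ : S => ℂ) 2) (s : Finset S) :
    ∑ i ∈ s, ‖y i‖ ^ 2 ≤ ‖y‖ ^ 2 := by
  simpa using lp.sum_rpow_le_norm_rpow (p := 2) (by simp) y s

theorem lp_two_norm_sum_single {S : Type*} [DecidableEq S] (s : Finset S) (c : S → ℂ) :
    ‖∑ i ∈ s, lp.single (E := fun _ : S => ℂ) 2 i (c i)‖ = √(∑ i ∈ s, ‖c i‖ ^ 2) := by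
  have := lp.norm_sum_single (p := 2) (E := fun _ : S => ℂ) (by simp) c s
  rw [eq_comm, Real.sqrt_eq_iff_eq_sq (by positivity) (by positivity)]
  simpa using this.symm

/-- Every bounded operator has a matrix. -/
theorem isMatrixOf_single {S T : Type*} [DecidableEq T]
    (A : lp (fun _ : T => ℂ) 2 →L[ℂ] lp (fun _ : S => ℂ) 2) :
    IsMatrixOf (fun s t => A (lp.single 2 t 1) s) A := by
  intro x s
  have h := ((lp.evalCLM ℂ (fun _ : S => ℂ) 2 s).comp A).hasSum
    (lp.hasSum_single (p := 2) (by simp) x)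
  refine h.congr_fun fun t => ?_
  have : lp.single (E := fun _ : T => ℂ) 2 t (x t) = x t • lp.single (E := fun _ : T => ℂ) 2 t 1 := by
    rw [← lp.single_smul]; simp
  rw [this, map_smul, smul_eq_mul, mul_comm]
  rfl

theorem IsMatrixOf.apply_single {S T : Type*} [DecidableEq T] {a : S → T → ℂ}
    {A : lp (fun _ : T => ℂ) 2 →L[ℂ] lp (fun _ : S => ℂ) 2} (h : IsMatrixOf a A) (s : S) (t : T) :
    A (lp.single 2 t 1) s = a s t := by
  refine (h _ s).unique ?_
  convert hasSum_single t ?_ using 1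
  · simp
  · intro j hj
    simp [Pi.single_eq_of_ne hj]

theorem IsMatrixOf.unique {S T : Type*} {a : S → T → ℂ}
    {A B : lp (fun _ : T => ℂ) 2 →L[ℂ] lp (fun _ : S => ℂ) 2} (hA : IsMatrixOf a A)
    (hB : IsMatrixOf a B) : A = B := by
  ext x s
  exact (hA x s).unique (hB x s)

theorem IsMatrixOf.formBound {S T : Type*} {a : S → T → ℂ}
    {A : lp (fun _ : T => ℂ) 2 →L[ℂ] lp (fun _ : S => ℂ) 2} (h : IsMatrixOf a A) :
    FormBound a ‖A‖ := by
  classical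
  intro s t d c
  set x := ∑ j ∈ t, lp.single (E := fun _ : T => ℂ) 2 j (c j) with hx
  set y := ∑ i ∈ s, lp.single (E := fun _ : S => ℂ) 2 i (star (d i)) with hy
  have hAx : ∀ i, A x i = ∑ j ∈ t, a i j * c j := by
    intro i
    have h1 : x = ∑ j ∈ t, c j • lp.single (E := fun _ : T => ℂ) 2 j 1 := by
      rw [hx]
      refine Finset.sum_congr rfl fun j _ => ?_
      rw [← lp.single_smul]; simp
    rw [h1, map_sum, lp.coeFn_sum, Finset.sum_apply]
    refine Finset.sum_congr rfl fun j _ => ?_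
    rw [map_smul, lp.coeFn_smul, Pi.smul_apply, h.apply_single, smul_eq_mul, mul_comm]
  have h2 : ∑ i ∈ s, ∑ j ∈ t, d i * a i j * c j = inner ℂ y (A x) := by
    rw [hy, sum_inner]
    refine Finset.sum_congr rfl fun i _ => ?_
    rw [lp.inner_single_left, hAx]
    simp [Finset.mul_sum, mul_comm, mul_left_comm]
  rw [h2]
  calc _ ≤ ‖y‖ * ‖A x‖ := norm_inner_le_norm _ _
    _ ≤ ‖y‖ * (‖A‖ * ‖x‖) := by gcongr; exact A.le_opNorm x
    _ = _ := by
      rw [hx, hy, lp_two_norm_sum_single, lp_two_norm_sum_single]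
      simp only [norm_star]; ring

/-- Each row, tested against its own conjugate, is square summable, so the operator can be defined
by inner products with the rows. Its norm is bounded by testing against the conjugates of its values
and letting the finite set of columns grow. -/
theorem FormBound.exists_isMatrixOf {S T : Type*} {a : S → T → ℂ} {C : ℝ} (hC : 0 ≤ C)
    (h : FormBound a C) :
    ∃ A : lp (fun _ : T => ℂ) 2 →L[ℂ] lp (fun _ : S => ℂ) 2, IsMatrixOf a A ∧ ‖A‖ ≤ C := by
  have hrow : ∀ i, Memℓp (fun j => star (a i j)) 2 := by
    intro i
    refine memLp_two_of_sum_le (K := C ^ 2) fun t => ?_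
    have h1 := h {i} t 1 (fun j => star (a i j))
    have h2 : ∑ i' ∈ {i}, ∑ j ∈ t, (1 : S → ℂ) i' * a i' j * star (a i j)
        = ((∑ j ∈ t, ‖a i j‖ ^ 2 : ℝ) : ℂ) := by
      simp [Complex.mul_conj']
    rw [h2, Complex.norm_real, Real.norm_of_nonneg (by positivity)] at h1
    simpa using le_sq_of_le_mul_sqrt (by positivity) hC (by simpa using h1)
  let r : S → lp (fun _ : T => ℂ) 2 := fun i => ⟨_, hrow i⟩
  have hsum : ∀ (x : lp (fun _ : T => ℂ) 2) (i : S),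
      HasSum (fun j => a i j * x j) (inner ℂ (r i) x) := by
    intro x i
    refine (lp.hasSum_inner (r i) x).congr_fun fun j => ?_
    simp [r, mul_comm]
  have key : ∀ (x : lp (fun _ : T => ℂ) 2) (s : Finset S),
      ∑ i ∈ s, ‖inner ℂ (r i) x‖ ^ 2 ≤ (C * ‖x‖) ^ 2 := by
    intro x s
    set d : S → ℂ := fun i => star (inner ℂ (r i) x) with hd
    have h1 : HasSum (fun j => ∑ i ∈ s, d i * a i j * x j) (∑ i ∈ s, d i * inner ℂ (r i) x) := by
      refine hasSum_sum fun i _ => ?_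
      simpa [mul_assoc] using (hsum x i).mul_left (d i)
    have h2 : ‖∑ i ∈ s, d i * inner ℂ (r i) x‖ ≤ C * √(∑ i ∈ s, ‖d i‖ ^ 2) * ‖x‖ := by
      refine le_of_tendsto h1.norm (Filter.Eventually.of_forall fun t => ?_)
      rw [Finset.sum_comm]
      refine (h s t d x).trans ?_
      gcongr
      rw [Real.sqrt_le_left (norm_nonneg x)]
      exact lp_two_sum_le x t
    have h3 : ∑ i ∈ s, d i * inner ℂ (r i) x = ((∑ i ∈ s, ‖inner ℂ (r i) x‖ ^ 2 : ℝ) : ℂ) := by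
      rw [Complex.ofReal_sum]
      refine Finset.sum_congr rfl fun i _ => ?_
      rw [hd, Complex.ofReal_pow]
      exact Complex.conj_mul' _
    rw [h3, Complex.norm_real, Real.norm_of_nonneg (by positivity)] at h2
    refine le_sq_of_le_mul_sqrt (by positivity) (by positivity) (h2.trans (le_of_eq ?_))
    simp only [hd, norm_star]
    ring
  let A : lp (fun _ : T => ℂ) 2 →ₗ[ℂ] lp (fun _ : S => ℂ) 2 :=
    { toFun := fun x => ⟨fun i => inner ℂ (r i) x, memLp_two_of_sum_le (key x)⟩
      map_add' := fun x y => by ext i; exact inner_add_right (r i) x y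
      map_smul' := fun c x => by ext i; exact inner_smul_right (r i) x c }
  refine ⟨A.mkContinuous C fun x => ?_, fun x i => ?_, ?_⟩
  · exact lp_two_norm_le _ (by positivity) (key x)
  · exact hsum x i
  · exact LinearMap.mkContinuous_norm_le _ hC _

theorem FormBound.mono {S T : Type*} {a : S → T → ℂ} {C D : ℝ} (h : FormBound a C) (hCD : C ≤ D) :
    FormBound a D := fun s t d c => (h s t d c).trans (by gcongr)

theorem matrixNorm_eq {S T : Type*} {a : S → T → ℂ}
    {A : lp (fun _ : T => ℂ) 2 →L[ℂ] lp (fun _ : S => ℂ) 2} (h : IsMatrixOf a A) :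
    matrixNorm a = ‖A‖ₑ := by
  refine le_antisymm (iInf₂_le A h) (le_iInf₂ fun B hB => ?_)
  rw [hB.unique h]

theorem matrixNorm_lt_top_iff {S T : Type*} {a : S → T → ℂ} :
    matrixNorm a < ∞ ↔ IsBoundedMatrix a := by
  constructor
  · intro h
    simp only [matrixNorm, iInf_lt_iff] at h
    obtain ⟨A, hA, -⟩ := h
    exact ⟨A, hA⟩
  · rintro ⟨A, hA⟩
    rw [matrixNorm_eq hA]
    exact enorm_lt_top

theorem matrixNorm_le_iff {S T : Type*} {a : S → T → ℂ} {C : ℝ≥0} :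
    matrixNorm a ≤ C ↔ FormBound a C := by
  constructor
  · intro h
    obtain ⟨A, hA⟩ := matrixNorm_lt_top_iff.1 (h.trans_lt ENNReal.coe_lt_top)
    refine hA.formBound.mono ?_
    rw [matrixNorm_eq hA] at h
    exact_mod_cast (by simpa [enorm] using h : ‖A‖₊ ≤ C)
  · intro h
    obtain ⟨A, hA, hn⟩ := h.exists_isMatrixOf C.2
    rw [matrixNorm_eq hA, enorm_eq_nnnorm, ENNReal.coe_le_coe]
    exact_mod_cast hn

/-! ### Operations on form bounds; the diagonal part. -/

theorem FormBound.norm_le {S T : Type*} {a : S → T → ℂ} {C : ℝ} (h : FormBound a C) (i : S)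
    (j : T) : ‖a i j‖ ≤ C := by
  simpa using h {i} {j} 1 1

theorem FormBound.smul {S T : Type*} {a : S → T → ℂ} {C : ℝ} (h : FormBound a C) (z : ℂ) :
    FormBound (fun i j => z * a i j) (‖z‖ * C) := by
  intro s t d c
  have : ∑ i ∈ s, ∑ j ∈ t, d i * (z * a i j) * c j
      = z * ∑ i ∈ s, ∑ j ∈ t, d i * a i j * c j := by
    simp only [Finset.mul_sum]
    exact Finset.sum_congr rfl fun i _ => Finset.sum_congr rfl fun j _ => by ring
  rw [this, norm_mul]
  calc _ ≤ ‖z‖ * _ := mul_le_mul_of_nonneg_left (h s t d c) (norm_nonneg z)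
    _ = _ := by ring

theorem FormBound.sub {S T : Type*} {a b : S → T → ℂ} {C D : ℝ} (ha : FormBound a C)
    (hb : FormBound b D) : FormBound (fun i j => a i j - b i j) (C + D) := by
  intro s t d c
  have : ∑ i ∈ s, ∑ j ∈ t, d i * (a i j - b i j) * c j
      = ∑ i ∈ s, ∑ j ∈ t, d i * a i j * c j - ∑ i ∈ s, ∑ j ∈ t, d i * b i j * c j := by
    simp only [← Finset.sum_sub_distrib]
    exact Finset.sum_congr rfl fun i _ => Finset.sum_congr rfl fun j _ => by ring
  rw [this]
  calc _ ≤ _ := norm_sub_le _ _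
    _ ≤ _ := add_le_add (ha s t d c) (hb s t d c)
    _ = _ := by ring

/-- The part of a matrix on the diagonal. -/
def diagPart {S : Type*} [DecidableEq S] (a : S → S → ℂ) : S → S → ℂ :=
  fun i j => if i = j then a i j else 0

theorem FormBound.diagPart {S : Type*} [DecidableEq S] {a : S → S → ℂ} {C : ℝ}
    (h : FormBound a C) : FormBound (diagPart a) C := by
  intro s t d c
  have h1 : ∑ i ∈ s, ∑ j ∈ t, d i * CommutatorLipschitz.diagPart a i j * c j
      = ∑ i ∈ s ∩ t, d i * a i i * c i := by
    simp [CommutatorLipschitz.diagPart]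
  rw [h1]
  rcases (s ∩ t).eq_empty_or_nonempty with he | ⟨i₀, -⟩
  · rw [he, Finset.sum_empty, norm_zero]
    -- Any entry forces `0 ≤ C`; without entries `C` may be negative, but all sums are empty.
    by_cases hS : Nonempty S
    · obtain ⟨i⟩ := hS
      have := (norm_nonneg _).trans (h.norm_le i i)
      positivity
    · have : IsEmpty S := not_nonempty_iff.1 hS
      simp [Finset.eq_empty_of_isEmpty]
  have hC := (norm_nonneg _).trans (h.norm_le i₀ i₀)
  calc ‖∑ i ∈ s ∩ t, d i * a i i * c i‖ ≤ ∑ i ∈ s ∩ t, ‖d i * a i i * c i‖ := norm_sum_le _ _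
    _ ≤ ∑ i ∈ s ∩ t, C * (‖d i‖ * ‖c i‖) := by
      refine Finset.sum_le_sum fun i _ => ?_
      rw [norm_mul, norm_mul]
      have := mul_le_mul_of_nonneg_right (h.norm_le i i)
        (mul_nonneg (norm_nonneg (d i)) (norm_nonneg (c i)))
      linarith
    _ = C * ∑ i ∈ s ∩ t, ‖d i‖ * ‖c i‖ := by rw [Finset.mul_sum]
    _ ≤ C * (√(∑ i ∈ s ∩ t, ‖d i‖ ^ 2) * √(∑ i ∈ s ∩ t, ‖c i‖ ^ 2)) := by
      gcongr
      exact Real.sum_mul_le_sqrt_mul_sqrt _ _ _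
    _ ≤ C * (√(∑ i ∈ s, ‖d i‖ ^ 2) * √(∑ i ∈ t, ‖c i‖ ^ 2)) := by
      gcongr
      · exact Finset.inter_subset_left
      · exact Finset.inter_subset_right
    _ = _ := by ring

/-! ### Comparison of the two Schur norms. -/

theorem schurNorm_le_iff {S T : Type*} {Φ : S → T → ℂ} {M : ℝ≥0} :
    schurNorm Φ ≤ M ↔ ∀ a : S → T → ℂ, FormBound a 1 → FormBound (schurMul Φ a) M := by
  simp only [schurNorm, iSup_le_iff, matrixNorm_le_iff]
  refine forall_congr' fun a => ?_
  rw [← ENNReal.coe_one, matrixNorm_le_iff, NNReal.coe_one]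

theorem schurNormZero_le_iff {X : Type*} {S T : Set X} {Φ : S → T → ℂ} {M : ℝ≥0} :
    schurNormZero Φ ≤ M ↔ ∀ a : S → T → ℂ, FormBound a 1 →
      (∀ (s : S) (t : T), (s : X) = (t : X) → a s t = 0) → FormBound (schurMul Φ a) M := by
  simp only [schurNormZero, iSup_le_iff, matrixNorm_le_iff]
  refine forall_congr' fun a => ?_
  rw [← ENNReal.coe_one, matrixNorm_le_iff, NNReal.coe_one]

/-- Homogeneity. The Schur bound is assumed only for the rescaled matrix, so that the lemma serves
both norms, with or without the zero-diagonal condition. -/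
theorem FormBound.schurMul_of_scaled {S T : Type*} {Φ a : S → T → ℂ} {M K : ℝ} (hK : 0 < K)
    (h : FormBound (fun i j => (K : ℂ)⁻¹ * a i j) 1 →
      FormBound (schurMul Φ fun i j => (K : ℂ)⁻¹ * a i j) M)
    (ha : FormBound a K) : FormBound (schurMul Φ a) (M * K) := by
  have h1 := ha.smul (K : ℂ)⁻¹
  have h2 : ‖(K : ℂ)⁻¹‖ * K = 1 := by
    rw [norm_inv, Complex.norm_real, Real.norm_of_nonneg hK.le, inv_mul_cancel₀ hK.ne']
  rw [h2] at h1
  have h3 := (h h1).smul (K : ℂ)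
  have hK' : (K : ℂ) ≠ 0 := by exact_mod_cast hK.ne'
  rw [Complex.norm_real, Real.norm_of_nonneg hK.le, mul_comm] at h3
  convert h3 using 3 with i j
  simp only [schurMul]
  field_simp

theorem schurNormZero_le_schurNorm {X : Type*} {S T : Set X} (Φ : S → T → ℂ) :
    schurNormZero Φ ≤ schurNorm Φ :=
  iSup_mono fun _ => iSup_mono fun _ => iSup_le fun _ => le_rfl

/-- `Φ` does not see the diagonal, and removing it from `a` gives a matrix of norm at most `1 + 1`.
-/
theorem schurNorm_le_two_mul_schurNormZero {X : Type*} {S : Set X} {Φ : S → S → ℂ}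
    (hΦ : ∀ s, Φ s s = 0) : schurNorm Φ ≤ 2 * schurNormZero Φ := by
  classical
  by_cases htop : schurNormZero Φ = ∞
  · simp [htop]
  lift schurNormZero Φ to ℝ≥0 using htop with M hM
  have hM' := schurNormZero_le_iff.1 hM.ge
  have : (2 : ℝ≥0∞) * M = ((2 * M : ℝ≥0) : ℝ≥0∞) := by push_cast; rfl
  rw [this, schurNorm_le_iff]
  intro a ha
  have h1 := (ha.sub ha.diagPart).schurMul_of_scaled (Φ := Φ) (M := M) (by norm_num) fun h => by
    refine hM' _ h fun s t hst => ?_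
    simp [diagPart, Subtype.ext hst]
  have h2 : schurMul Φ (fun i j => a i j - diagPart a i j) = schurMul Φ a := by
    ext i j
    by_cases hij : i = j
    · simp [schurMul, hij, hΦ]
    · simp [schurMul, diagPart, hij]
  rw [h2] at h1
  refine h1.mono (le_of_eq ?_)
  push_cast
  ring

/-! ### Schur multipliers have finite norm. -/

theorem ext_single {S T : Type*} [DecidableEq T]
    {A B : lp (fun _ : T => ℂ) 2 →L[ℂ] lp (fun _ : S => ℂ) 2}
    (h : ∀ s t, A (lp.single 2 t 1) s = B (lp.single 2 t 1) s) : A = B := by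
  have hA := isMatrixOf_single A
  simp only [h] at hA
  exact hA.unique (isMatrixOf_single B)

/-- By the closed graph theorem, a Schur multiplier acts boundedly. -/
theorem isSchurMultiplier_iff {S T : Type*} {Φ : S → T → ℂ} :
    IsSchurMultiplier Φ ↔ schurNorm Φ < ∞ := by
  classical
  constructor
  · intro h
    have h' : ∀ A : lp (fun _ : T => ℂ) 2 →L[ℂ] lp (fun _ : S => ℂ) 2,
        ∃ B : lp (fun _ : T => ℂ) 2 →L[ℂ] lp (fun _ : S => ℂ) 2,
          IsMatrixOf (schurMul Φ fun s t => A (lp.single 2 t 1) s) B :=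
      fun A => h _ ⟨A, isMatrixOf_single A⟩
    choose B hB using h'
    have hent : ∀ A s t, B A (lp.single 2 t 1) s = Φ s t * A (lp.single 2 t 1) s :=
      fun A s t => (hB A).apply_single s t
    let L : (lp (fun _ : T => ℂ) 2 →L[ℂ] lp (fun _ : S => ℂ) 2) →ₗ[ℂ]
        (lp (fun _ : T => ℂ) 2 →L[ℂ] lp (fun _ : S => ℂ) 2) :=
      { toFun := B
        map_add' := fun A A' => ext_single fun s t => by
          simp only [hent, add_apply, lp.coeFn_add, Pi.add_apply, mul_add]
        map_smul' := fun c A => ext_single fun s t => by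
          simp only [hent, smul_apply, lp.coeFn_smul, Pi.smul_apply,
            smul_eq_mul, RingHom.id_apply]
          ring }
    have hev : ∀ (s : S) (t : T), Continuous
        fun A : lp (fun _ : T => ℂ) 2 →L[ℂ] lp (fun _ : S => ℂ) 2 => A (lp.single 2 t 1) s :=
      fun s t => (lp.evalCLM ℂ (fun _ : S => ℂ) 2 s).continuous.comp
        (ContinuousLinearMap.apply ℂ _ (lp.single (E := fun _ : T => ℂ) 2 t 1)).continuous
    -- Entries depend continuously on the operator, so a limit along the graph is identified entry
    -- by entry.
    have hL : Continuous L := by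
      refine L.continuous_of_seq_closed_graph fun v x y hv hLv => ext_single fun s t => ?_
      have h1 := ((hev s t).tendsto y).comp hLv
      have h2 := (((hev s t).tendsto x).comp hv).const_mul (Φ s t)
      refine (tendsto_nhds_unique h1 (h2.congr fun n => ?_)).trans (hent x s t).symm
      exact (hent (v n) s t).symm
    let L' : (lp (fun _ : T => ℂ) 2 →L[ℂ] lp (fun _ : S => ℂ) 2) →L[ℂ]
        (lp (fun _ : T => ℂ) 2 →L[ℂ] lp (fun _ : S => ℂ) 2) := ⟨L, hL⟩
    refine lt_of_le_of_lt (b := ((‖L'‖₊ : ℝ≥0) : ℝ≥0∞)) ?_ ENNReal.coe_lt_top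
    rw [schurNorm_le_iff]
    intro a ha
    obtain ⟨A, hA, hn⟩ := ha.exists_isMatrixOf zero_le_one
    have h3 : IsMatrixOf (schurMul Φ a) (L' A) := by
      have h4 := hB A
      simp only [hA.apply_single] at h4
      exact h4
    refine h3.formBound.mono ((L'.le_opNorm A).trans ?_)
    rw [coe_nnnorm]
    exact mul_le_of_le_one_right (norm_nonneg _) hn
  · intro h a ⟨A, hA⟩
    lift schurNorm Φ to ℝ≥0 using h.ne with M hM
    have hM' := schurNorm_le_iff.1 hM.ge
    have h1 : FormBound a (‖A‖ + 1) := hA.formBound.mono (by linarith)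
    have h2 := h1.schurMul_of_scaled (Φ := Φ) (M := M) (by positivity) (hM' _)
    obtain ⟨B, hB, -⟩ := h2.exists_isMatrixOf (by positivity)
    exact ⟨B, hB⟩

/-! ### Lower bound: finite diagonal operators. -/

theorem opNorm_le_of_norm_inner_le {H : Type*} [NormedAddCommGroup H] [InnerProductSpace ℂ H]
    (A : H →L[ℂ] H) {C : ℝ} (hC : 0 ≤ C) (h : ∀ x y, ‖inner ℂ y (A x)‖ ≤ C * ‖y‖ * ‖x‖) :
    ‖A‖ ≤ C := by
  refine A.opNorm_le_bound hC fun x => ?_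
  have h1 := h x (A x)
  rw [inner_self_eq_norm_sq_to_K, norm_pow, norm_algebraMap', norm_norm] at h1
  rcases (norm_nonneg (A x)).eq_or_lt with h0 | h0
  · rw [← h0]; positivity
  · nlinarith

/-- The functional calculus of a diagonal matrix acts on the diagonal. -/
theorem cfcHomSuperset_diagonal {ι : Type*} [Fintype ι] [DecidableEq ι] {F : Set ℂ} (lam : ι → F)
    (N : EuclideanSpace ℂ ι →L[ℂ] EuclideanSpace ℂ ι)
    (hNl : N = Matrix.toEuclideanCLM (𝕜 := ℂ) (Matrix.diagonal fun i => (lam i : ℂ)))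
    (hN : IsStarNormal N) (hF : spectrum ℂ N ⊆ F)
    (hsp : spectrum ℂ N = Set.range fun i => (lam i : ℂ))
    (g : C(F, ℂ)) :
    cfcHomSuperset hN hF g
      = Matrix.toEuclideanCLM (𝕜 := ℂ) (Matrix.diagonal fun i => g (lam i)) := by
  classical
  let r : ℂ → ℂ := fun z => if h : z ∈ F then g ⟨z, h⟩ else 0
  -- On a finite spectrum `g` agrees with a polynomial, and polynomials act entrywise on diagonal
  -- matrices. Passing to the image removes repeated eigenvalues.
  let p := Lagrange.interpolate (Finset.univ.image fun i => (lam i : ℂ)) id r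
  have hp : ∀ i, p.eval (lam i : ℂ) = g (lam i) := by
    intro i
    have := Lagrange.eval_interpolate_at_node (s := Finset.univ.image fun i => (lam i : ℂ))
      (v := id) r (i := (lam i : ℂ)) Function.injective_id.injOn (by simp)
    simpa only [r, id, (lam i).2, dif_pos, Subtype.coe_eta] using this
  have h1 : cfcHomSuperset hN hF g = cfc p.eval N := by
    rw [cfc_apply p.eval N hN, cfcHomSuperset_apply]
    congr 1
    ext ⟨z, hz⟩
    have hz' := hz
    rw [hsp] at hz'
    obtain ⟨i, rfl⟩ := hz'
    exact (hp i).symm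
  rw [h1, cfc_polynomial p N hN, hNl]
  have h2 := Polynomial.aeval_algHom_apply
    (Matrix.toEuclideanCLM (𝕜 := ℂ) (n := ι)).toAlgEquiv.toAlgHom
    (Matrix.diagonal fun i => (lam i : ℂ)) p
  have h3 := Polynomial.aeval_algHom_apply (Matrix.diagonalAlgHom ℂ (n := ι) (α := ℂ))
    (fun i => (lam i : ℂ)) p
  have h4 : Polynomial.aeval (fun i => (lam i : ℂ)) p = fun i => g (lam i) := by
    ext i
    rw [Polynomial.aeval_pi_apply, ← hp]
    simp [Polynomial.aeval_def]
  rw [h4] at h3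
  exact h2.trans (congrArg (Matrix.toEuclideanCLM (𝕜 := ℂ) (n := ι)) h3)

theorem formBound_norm_toEuclideanCLM {ι : Type*} [Fintype ι] [DecidableEq ι] (a : ι → ι → ℂ) :
    FormBound a ‖Matrix.toEuclideanCLM (𝕜 := ℂ) (Matrix.of a)‖ := by
  intro s t d c
  let x : EuclideanSpace ℂ ι := WithLp.toLp 2 fun j => if j ∈ t then c j else 0
  let y : EuclideanSpace ℂ ι := WithLp.toLp 2 fun i => if i ∈ s then star (d i) else 0
  have h1 : ∑ i ∈ s, ∑ j ∈ t, d i * a i j * c j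
      = inner ℂ y (Matrix.toEuclideanCLM (𝕜 := ℂ) (Matrix.of a) x) := by
    simp [PiLp.inner_apply, x, y, Matrix.mulVec, dotProduct, apply_ite, Finset.mul_sum,
      mul_comm, mul_left_comm]
  have hx : ‖x‖ = √(∑ j ∈ t, ‖c j‖ ^ 2) := by
    simp [x, EuclideanSpace.norm_eq, apply_ite, ite_pow]
  have hy : ‖y‖ = √(∑ j ∈ s, ‖d j‖ ^ 2) := by
    simp [y, EuclideanSpace.norm_eq, apply_ite, ite_pow]
  rw [h1, ← hx, ← hy]
  calc _ ≤ ‖y‖ * ‖Matrix.toEuclideanCLM (𝕜 := ℂ) (Matrix.of a) x‖ := norm_inner_le_norm _ _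
    _ ≤ ‖y‖ * (‖Matrix.toEuclideanCLM (𝕜 := ℂ) (Matrix.of a)‖ * ‖x‖) := by
      gcongr; exact ContinuousLinearMap.le_opNorm _ x
    _ = _ := by ring

theorem FormBound.norm_toEuclideanCLM_le {ι : Type*} [Fintype ι] [DecidableEq ι] {a : ι → ι → ℂ}
    {C : ℝ} (hC : 0 ≤ C) (h : FormBound a C) :
    ‖Matrix.toEuclideanCLM (𝕜 := ℂ) (Matrix.of a)‖ ≤ C := by
  refine opNorm_le_of_norm_inner_le _ hC fun x y => ?_
  have h1 := h Finset.univ Finset.univ (fun i => star (y i)) x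
  have h2 : ∑ i, ∑ j, star (y i) * a i j * x j
      = inner ℂ y (Matrix.toEuclideanCLM (𝕜 := ℂ) (Matrix.of a) x) := by
    rw [PiLp.inner_apply]
    refine Finset.sum_congr rfl fun i _ => ?_
    rw [RCLike.inner_apply, Matrix.ofLp_toEuclideanCLM, Matrix.mulVec, dotProduct, Finset.sum_mul]
    refine Finset.sum_congr rfl fun j _ => ?_
    rw [Matrix.of_apply, starRingEnd_apply]
    ring
  rw [h2] at h1
  simpa [EuclideanSpace.norm_eq] using h1

theorem FormBound.comp {S T S' T' : Type*} {a : S → T → ℂ} {C : ℝ} (h : FormBound a C)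
    (e : S' ↪ S) (e' : T' ↪ T) : FormBound (fun i j => a (e i) (e' j)) C := by
  intro s t d c
  have h1 := h (s.map e) (t.map e') (Function.extend e d 0) (Function.extend e' c 0)
  simpa [Finset.sum_map, e.injective.extend_apply, e'.injective.extend_apply] using h1

/-- The row and column sets are merged into one finite index set. `ULift` puts it in the universe of
the Hilbert spaces over which `IsCLConst` quantifies. -/
theorem FormBound.of_finite {S : Type*} {a : S → S → ℂ} {C : ℝ}
    (h : ∀ U : Finset S, FormBound (fun i j : ULift.{u} U => a i.down j.down) C) :
    FormBound a C := by
  classical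
  intro s t d c
  let e : ULift.{u} (s ∪ t : Finset S) ↪ S :=
    ⟨fun i => i.down, fun i j hij => ULift.ext _ _ (Subtype.ext hij)⟩
  have hs : s ⊆ Finset.univ.map e := fun i hi =>
    Finset.mem_map.2 ⟨⟨⟨i, Finset.mem_union_left t hi⟩⟩, Finset.mem_univ _, rfl⟩
  have ht : t ⊆ Finset.univ.map e := fun i hi =>
    Finset.mem_map.2 ⟨⟨⟨i, Finset.mem_union_right s hi⟩⟩, Finset.mem_univ _, rfl⟩
  obtain ⟨s', -, hs'⟩ := Finset.subset_map_iff.1 hs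
  obtain ⟨t', -, ht'⟩ := Finset.subset_map_iff.1 ht
  have h1 := h (s ∪ t) s' t' (fun i => d i.down) (fun i => c i.down)
  have h2 : ∀ g : S → ℝ, ∑ i ∈ s, g i = ∑ i ∈ s', g i.down := fun g => by
    rw [Finset.sum_congr hs' fun _ _ => rfl, Finset.sum_map]; rfl
  have h3 : ∀ g : S → ℝ, ∑ i ∈ t, g i = ∑ i ∈ t', g i.down := fun g => by
    rw [Finset.sum_congr ht' fun _ _ => rfl, Finset.sum_map]; rfl
  have h4 : ∀ g : S → ℂ, ∑ i ∈ s, g i = ∑ i ∈ s', g i.down := fun g => by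
    rw [Finset.sum_congr hs' fun _ _ => rfl, Finset.sum_map]; rfl
  have h5 : ∀ g : S → ℂ, ∑ i ∈ t, g i = ∑ i ∈ t', g i.down := fun g => by
    rw [Finset.sum_congr ht' fun _ _ => rfl, Finset.sum_map]; rfl
  simpa only [h2, h3, h4, h5] using h1

theorem schurNormZero_le_of_isCLConst {F : Set ℂ} {f : F → ℂ} {C : ℝ≥0} (h : IsCLConst.{u} f C) :
    schurNormZero (dividedDiff f) ≤ C := by
  classical
  obtain ⟨hf, h⟩ := h
  rw [schurNormZero_le_iff]
  intro a ha ha0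
  refine FormBound.of_finite.{u} fun U => ?_
  let ι := ULift.{u} U
  let lam : ι → F := fun i => i.down
  let e : ι ↪ F := ⟨lam, fun i j hij => ULift.ext _ _ (Subtype.ext hij)⟩
  let N := Matrix.toEuclideanCLM (𝕜 := ℂ) (Matrix.diagonal fun i => (lam i : ℂ))
  -- Solves `N * R - R * N = a`; the diagonal entries of `R` are `0` by the convention for division
  -- by zero.
  let R := Matrix.toEuclideanCLM (𝕜 := ℂ)
    (Matrix.of fun i j : ι => a (lam i) (lam j) / ((lam i : ℂ) - (lam j : ℂ)))
  have hsp : spectrum ℂ N = Set.range fun i => (lam i : ℂ) := by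
    rw [← spectrum_diagonal (R := ℂ) fun i => (lam i : ℂ)]
    exact AlgEquiv.spectrum_eq (Matrix.toEuclideanCLM (𝕜 := ℂ) (n := ι)) _
  have hF : spectrum ℂ N ⊆ F := by
    rw [hsp]
    rintro _ ⟨i, rfl⟩
    exact (lam i).2
  have hN : IsStarNormal N := by
    refine ⟨?_⟩
    simp only [N, ← map_star, Commute, SemiconjBy, ← map_mul]
    congr 1
    simp [Matrix.star_eq_conjTranspose, Matrix.diagonal_conjTranspose, mul_comm]
  have h1 := h (EuclideanSpace ℂ ι) N R hN hF
  rw [cfcHomSuperset_diagonal lam N rfl hN hF hsp] at h1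
  have hne : ∀ i j : ι, i ≠ j → (lam i : ℂ) - lam j ≠ 0 := fun i j hij h0 =>
    hij (e.injective (Subtype.ext (sub_eq_zero.1 h0)))
  have h2 : N * R - R * N = Matrix.toEuclideanCLM (𝕜 := ℂ)
      (Matrix.of fun i j : ι => a (lam i) (lam j)) := by
    simp only [N, R, ← map_mul, ← map_sub]
    congr 1
    ext i j
    simp only [Matrix.sub_apply, Matrix.diagonal_mul, Matrix.mul_diagonal, Matrix.of_apply]
    by_cases hij : i = j
    · subst hij; simp [ha0 (lam i) (lam i) rfl]
    · have := hne i j hij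
      field_simp
  have h3 : Matrix.toEuclideanCLM (𝕜 := ℂ) (Matrix.diagonal fun i => f (lam i)) * R
      - R * Matrix.toEuclideanCLM (𝕜 := ℂ) (Matrix.diagonal fun i => f (lam i))
      = Matrix.toEuclideanCLM (𝕜 := ℂ)
      (Matrix.of fun i j : ι => schurMul (dividedDiff f) a (lam i) (lam j)) := by
    simp only [R, ← map_mul, ← map_sub]
    congr 1
    ext i j
    simp only [Matrix.sub_apply, Matrix.diagonal_mul, Matrix.mul_diagonal, Matrix.of_apply,
      schurMul, dividedDiff]
    by_cases hij : i = j
    · subst hij; simp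
    · rw [if_neg fun h0 : lam i = lam j => hij (e.injective h0)]
      have := hne i j hij
      field_simp
  rw [h2] at h1
  have h4 := (ha.comp e e).norm_toEuclideanCLM_le zero_le_one
  refine (formBound_norm_toEuclideanCLM _).mono ?_
  have h5 := h1.trans (mul_le_of_le_one_right C.2 h4)
  simp only [ContinuousMap.coe_mk] at h5
  rw [h3] at h5
  exact h5

/-! ### Upper bound: approximate diagonalisation of a normal operator. -/

/-- A partition `∑ h j ^ 2 = 1` into real functions supported near the points `j`. -/
theorem exists_sq_partition {X : Type*} [TopologicalSpace X] [CompactSpace X] {F : Set ℂ}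
    (lam : C(X, F)) {ε : ℝ} (hε : 0 < ε) :
    ∃ (t : Finset F) (h : F → C(X, ℂ)), ∑ j ∈ t, h j * h j = 1 ∧
      (∀ (s : Finset F) z, ∑ j ∈ s, ‖h j z‖ ^ 2 ≤ 1) ∧
      ∀ j z, h j z ≠ 0 → dist (lam z) j ≤ ε := by
  classical
  obtain ⟨t, ht⟩ := isCompact_univ.elim_finite_subcover
    (fun j : F => {z : X | dist (lam z) j < ε})
    (fun j => isOpen_lt (by fun_prop) continuous_const)
    (fun z _ => Set.mem_iUnion.2 ⟨lam z, by simpa using hε⟩)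
  let b : F → X → ℝ := fun j z => if j ∈ t then max 0 (ε - dist (lam z) j) else 0
  have hb : ∀ j, Continuous (b j) := fun j => by
    by_cases hj : j ∈ t <;> simp only [b, hj, if_true, if_false] <;> fun_prop
  let q : X → ℝ := fun z => ∑ j ∈ t, b j z ^ 2
  have hqc : Continuous q := by fun_prop
  have hq : ∀ z, 0 < q z := by
    intro z
    obtain ⟨j, hj, hz⟩ := Set.mem_iUnion₂.1 (ht (Set.mem_univ z))
    have hz' : dist (lam z) j < ε := hz
    refine Finset.sum_pos' (fun _ _ => sq_nonneg _) ⟨j, hj, ?_⟩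
    have : 0 < b j z := by
      simp only [b, hj, if_true]
      exact lt_max_of_lt_right (by linarith)
    positivity
  have hsq : Continuous fun z => √(q z) := by fun_prop
  have hne : ∀ z, √(q z) ≠ 0 := fun z => (Real.sqrt_pos.2 (hq z)).ne'
  let h : F → C(X, ℂ) := fun j =>
    ⟨fun z => ((b j z / √(q z) : ℝ) : ℂ), Complex.continuous_ofReal.comp ((hb j).div hsq hne)⟩
  have hh : ∀ j z, h j z = ((b j z / √(q z) : ℝ) : ℂ) := fun _ _ => rfl
  have hsum : ∀ z, ∑ j ∈ t, (b j z / √(q z)) ^ 2 = 1 := by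
    intro z
    simp only [div_pow, Real.sq_sqrt (hq z).le, ← Finset.sum_div]
    exact div_self (hq z).ne'
  refine ⟨t, h, ?_, fun s z => ?_, fun j z hjz => ?_⟩
  · ext z
    simp only [ContinuousMap.sum_apply, ContinuousMap.mul_apply, hh, ContinuousMap.one_apply]
    rw [← Complex.ofReal_one, ← hsum z, Complex.ofReal_sum]
    exact Finset.sum_congr rfl fun j _ => by push_cast; ring
  · rw [← hsum z]
    have h1 : ∀ j, ‖h j z‖ ^ 2 = (b j z / √(q z)) ^ 2 := fun j => by
      rw [hh, Complex.norm_real, Real.norm_eq_abs, sq_abs]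
    simp only [h1]
    -- The functions indexed outside `t` vanish, so the bound holds for every finite `s`.
    rw [← Finset.sum_inter_add_sum_sdiff s t]
    have h2 : ∑ j ∈ s \ t, (b j z / √(q z)) ^ 2 = 0 := by
      refine Finset.sum_eq_zero fun j hj => ?_
      simp [b, (Finset.mem_sdiff.1 hj).2]
    rw [h2, add_zero]
    exact Finset.sum_le_sum_of_subset_of_nonneg Finset.inter_subset_right
      fun _ _ _ => sq_nonneg _
  · by_contra! hc
    refine hjz ?_
    have : b j z = 0 := by
      simp only [b]
      split_ifs
      · exact max_eq_left (by linarith)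
      · rfl
    rw [hh, this]
    simp

/-- The unit vector in the direction of `x`, or `0`. -/
def direction {H : Type*} [NormedAddCommGroup H] [InnerProductSpace ℂ H]
    (x : H) : H := ((‖x‖ : ℂ)⁻¹) • x

theorem norm_direction_le {H : Type*} [NormedAddCommGroup H] [InnerProductSpace ℂ H]
    (x : H) : ‖direction x‖ ≤ 1 := by
  rw [direction, norm_smul, norm_inv, Complex.norm_real, norm_norm]
  exact inv_mul_le_one

theorem norm_smul_direction {H : Type*} [NormedAddCommGroup H] [InnerProductSpace ℂ H]
    (x : H) : (‖x‖ : ℂ) • direction x = x := by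
  by_cases h : x = 0
  · simp [h]
  · rw [direction, smul_smul, mul_inv_cancel₀ (by simpa using h), one_smul]

theorem inner_rep_left {X : Type*} [TopologicalSpace X] {H : Type*} [NormedAddCommGroup H]
    [InnerProductSpace ℂ H] [CompleteSpace H] (π : C(X, ℂ) →⋆ₐ[ℂ] (H →L[ℂ] H))
    (g : C(X, ℂ)) (x y : H) :
    inner ℂ (π g x) y = inner ℂ x (π (star g) y) := by
  rw [map_star, ContinuousLinearMap.star_eq_adjoint, ContinuousLinearMap.adjoint_inner_right]

section Rep

variable {X : Type*} [TopologicalSpace X] [CompactSpace X] {H : Type*} [NormedAddCommGroup H]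
  [InnerProductSpace ℂ H] [CompleteSpace H] (π : C(X, ℂ) →⋆ₐ[ℂ] (H →L[ℂ] H))

/-- The left side is the quadratic form of `π (∑ star (g j) * g j)`, and a star homomorphism is
contractive. -/
theorem sum_norm_sq_rep_le {J : Type*} (s : Finset J) (g : J → C(X, ℂ)) {K : ℝ}
    (hg : ∀ z, ∑ j ∈ s, ‖g j z‖ ^ 2 ≤ K ^ 2) (y : H) :
    ∑ j ∈ s, ‖π (g j) y‖ ^ 2 ≤ (K * ‖y‖) ^ 2 := by
  have h1 : ((∑ j ∈ s, ‖π (g j) y‖ ^ 2 : ℝ) : ℂ)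
      = inner ℂ y (π (∑ j ∈ s, star (g j) * g j) y) := by
    rw [map_sum, sum_apply, inner_sum, Complex.ofReal_sum]
    refine Finset.sum_congr rfl fun j _ => ?_
    rw [map_mul, mul_apply_eq_comp, ← inner_rep_left, inner_self_eq_norm_sq_to_K]
    push_cast
    rfl
  have h2 : ‖∑ j ∈ s, star (g j) * g j‖ ≤ K ^ 2 := by
    rw [ContinuousMap.norm_le _ (by positivity)]
    intro z
    have : (∑ j ∈ s, star (g j) * g j) z = ((∑ j ∈ s, ‖g j z‖ ^ 2 : ℝ) : ℂ) := by
      simp [ContinuousMap.sum_apply, Complex.conj_mul']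
    rw [this, Complex.norm_real, Real.norm_of_nonneg (by positivity)]
    exact hg z
  have h3 : ‖π (∑ j ∈ s, star (g j) * g j)‖ ≤ K ^ 2 :=
    (NonUnitalStarAlgHom.norm_apply_le π _).trans h2
  calc ∑ j ∈ s, ‖π (g j) y‖ ^ 2 = ‖((∑ j ∈ s, ‖π (g j) y‖ ^ 2 : ℝ) : ℂ)‖ := by
        rw [Complex.norm_real, Real.norm_of_nonneg (by positivity)]
    _ ≤ ‖y‖ * ‖π (∑ j ∈ s, star (g j) * g j) y‖ := by rw [h1]; exact norm_inner_le_norm _ _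
    _ ≤ ‖y‖ * (K ^ 2 * ‖y‖) := by
        gcongr
        exact (ContinuousLinearMap.le_opNorm _ _).trans (by gcongr)
    _ = _ := by ring

/-- The row operator is the adjoint of the column operator for `star (g j)`, so it inherits the
bound of `sum_norm_sq_rep_le`. -/
theorem norm_sum_rep_le {J : Type*} (s : Finset J) (g : J → C(X, ℂ)) {K : ℝ} (hK : 0 ≤ K)
    (hg : ∀ z, ∑ j ∈ s, ‖g j z‖ ^ 2 ≤ K ^ 2) (x : J → H) :
    ‖∑ j ∈ s, π (g j) (x j)‖ ≤ K * √(∑ j ∈ s, ‖x j‖ ^ 2) := by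
  set w := ∑ j ∈ s, π (g j) (x j) with hw
  have h1 : (‖w‖ : ℂ) ^ 2 = ∑ j ∈ s, inner ℂ (x j) (π (star (g j)) w) := by
    have := inner_self_eq_norm_sq_to_K (𝕜 := ℂ) w
    rw [hw, sum_inner, ← hw] at this
    simp only [inner_rep_left] at this
    exact this.symm
  have h2 : ∑ j ∈ s, ‖π (star (g j)) w‖ ^ 2 ≤ (K * ‖w‖) ^ 2 :=
    sum_norm_sq_rep_le π s (fun j => star (g j)) (by simpa using hg) w
  have h3 : ‖w‖ ^ 2 ≤ √(∑ j ∈ s, ‖x j‖ ^ 2) * (K * ‖w‖) := by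
    calc ‖w‖ ^ 2 = ‖(‖w‖ : ℂ) ^ 2‖ := by simp
      _ ≤ ∑ j ∈ s, ‖x j‖ * ‖π (star (g j)) w‖ := by
        rw [h1]
        exact (norm_sum_le _ _).trans (Finset.sum_le_sum fun j _ => norm_inner_le_norm _ _)
      _ ≤ √(∑ j ∈ s, ‖x j‖ ^ 2) * √(∑ j ∈ s, ‖π (star (g j)) w‖ ^ 2) :=
        Real.sum_mul_le_sqrt_mul_sqrt _ _ _
      _ ≤ _ := by
        gcongr
        exact (Real.sqrt_le_left (by positivity)).2 h2
  rcases (norm_nonneg w).eq_or_lt with h0 | h0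
  · rw [← h0]; positivity
  · nlinarith

/-- On the block of `h j` the operator `π g` is within `δ` of the scalar `κ j`: the difference has
symbols `(κ j - g) * h j`, whose squares sum to at most `δ ^ 2`. -/
theorem norm_sum_smul_rep_sub_le {J : Type*} (s : Finset J) (h : J → C(X, ℂ))
    (hh : ∀ z, ∑ j ∈ s, ‖h j z‖ ^ 2 ≤ 1) (κ : J → ℂ) (g : C(X, ℂ)) {δ : ℝ} (hδ : 0 ≤ δ)
    (hκ : ∀ j z, h j z ≠ 0 → ‖κ j - g z‖ ≤ δ) (x : J → H) :
    ‖∑ j ∈ s, κ j • π (h j) (x j) - π g (∑ j ∈ s, π (h j) (x j))‖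
      ≤ δ * √(∑ j ∈ s, ‖x j‖ ^ 2) := by
  have h1 : ∑ j ∈ s, κ j • π (h j) (x j) - π g (∑ j ∈ s, π (h j) (x j))
      = ∑ j ∈ s, π (κ j • h j - g * h j) (x j) := by
    rw [map_sum, ← Finset.sum_sub_distrib]
    refine Finset.sum_congr rfl fun j _ => ?_
    rw [map_sub, map_smul, map_mul]
    rfl
  rw [h1]
  refine norm_sum_rep_le π s _ hδ (fun z => ?_) x
  calc ∑ j ∈ s, ‖(κ j • h j - g * h j) z‖ ^ 2 ≤ ∑ j ∈ s, δ ^ 2 * ‖h j z‖ ^ 2 := by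
        refine Finset.sum_le_sum fun j _ => ?_
        have h2 : (κ j • h j - g * h j) z = (κ j - g z) * h j z := by
          simp [sub_mul]
        rw [h2, norm_mul, mul_pow]
        by_cases h0 : h j z = 0
        · simp [h0]
        · have := hκ j z h0
          gcongr
    _ = δ ^ 2 * ∑ j ∈ s, ‖h j z‖ ^ 2 := by rw [Finset.mul_sum]
    _ ≤ δ ^ 2 := mul_le_of_le_one_right (by positivity) (hh z)

/-- The compression of a commutator to the blocks of a partition. -/
theorem norm_sum_commutator_sub_le {J : Type*} (h : J → C(X, ℂ))
    (hh : ∀ (s : Finset J) z, ∑ j ∈ s, ‖h j z‖ ^ 2 ≤ 1) (κ : J → ℂ) (g : C(X, ℂ)) {δ : ℝ}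
    (hδ : 0 ≤ δ) (hκ : ∀ j z, h j z ≠ 0 → ‖κ j - g z‖ ≤ δ) (R : H →L[ℂ] H) (s t : Finset J)
    (y x : J → H) :
    ‖∑ i ∈ s, ∑ j ∈ t, (κ i - κ j) * inner ℂ (π (h i) (y i)) (R (π (h j) (x j)))
      - inner ℂ (∑ i ∈ s, π (h i) (y i)) ((π g * R - R * π g) (∑ j ∈ t, π (h j) (x j)))‖
      ≤ 2 * δ * ‖R‖ * √(∑ i ∈ s, ‖y i‖ ^ 2) * √(∑ j ∈ t, ‖x j‖ ^ 2) := by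
  set v := ∑ i ∈ s, π (h i) (y i) with hv
  set w := ∑ j ∈ t, π (h j) (x j) with hw
  set v' := ∑ i ∈ s, star (κ i) • π (h i) (y i) with hv'
  set w' := ∑ j ∈ t, κ j • π (h j) (x j) with hw'
  have hvn : ‖v‖ ≤ √(∑ i ∈ s, ‖y i‖ ^ 2) := by
    simpa using norm_sum_rep_le π s h zero_le_one (by simpa using hh s) y
  have hwn : ‖w‖ ≤ √(∑ j ∈ t, ‖x j‖ ^ 2) := by
    simpa using norm_sum_rep_le π t h zero_le_one (by simpa using hh t) x
  have hw1 : ‖w' - π g w‖ ≤ δ * √(∑ j ∈ t, ‖x j‖ ^ 2) :=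
    norm_sum_smul_rep_sub_le π t h (hh t) κ g hδ hκ x
  have hv1 : ‖v' - π (star g) v‖ ≤ δ * √(∑ i ∈ s, ‖y i‖ ^ 2) := by
    refine norm_sum_smul_rep_sub_le π s h (hh s) (fun i => star (κ i)) (star g) hδ
      (fun j z hz => ?_) y
    rw [ContinuousMap.star_apply, ← star_sub, norm_star]
    exact hκ j z hz
  have e1 : ∑ i ∈ s, ∑ j ∈ t, (κ i - κ j) * inner ℂ (π (h i) (y i)) (R (π (h j) (x j)))
      = inner ℂ v' (R w) - inner ℂ v (R w') := by
    rw [hv', hv, sum_inner, sum_inner, ← Finset.sum_sub_distrib]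
    refine Finset.sum_congr rfl fun i _ => ?_
    rw [hw, hw', map_sum, map_sum, inner_sum, inner_sum, ← Finset.sum_sub_distrib]
    refine Finset.sum_congr rfl fun j _ => ?_
    rw [inner_smul_left, map_smul, inner_smul_right, starRingEnd_apply, star_star, sub_mul]
  have e2 : inner ℂ v ((π g * R - R * π g) w)
      = inner ℂ (π (star g) v) (R w) - inner ℂ v (R (π g w)) := by
    rw [inner_rep_left, star_star, sub_apply, inner_sub_right]
    rfl
  -- Scalars are exchanged for `π g` once on each side of `R`; each exchange costs `δ * ‖R‖`, whence
  -- the factor 2.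
  have e3 : inner ℂ v' (R w) - inner ℂ v (R w')
      - (inner ℂ (π (star g) v) (R w) - inner ℂ v (R (π g w)))
      = inner ℂ (v' - π (star g) v) (R w) - inner ℂ v (R (w' - π g w)) := by
    rw [inner_sub_left, map_sub, inner_sub_right]
    ring
  rw [e1, e2, e3]
  calc _ ≤ ‖inner ℂ (v' - π (star g) v) (R w)‖ + ‖inner ℂ v (R (w' - π g w))‖ := norm_sub_le _ _
    _ ≤ ‖v' - π (star g) v‖ * (‖R‖ * ‖w‖) + ‖v‖ * (‖R‖ * ‖w' - π g w‖) := by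
      refine add_le_add ((norm_inner_le_norm _ _).trans ?_) ((norm_inner_le_norm _ _).trans ?_)
      · gcongr; exact R.le_opNorm _
      · gcongr; exact R.le_opNorm _
    _ ≤ (δ * √(∑ i ∈ s, ‖y i‖ ^ 2)) * (‖R‖ * √(∑ j ∈ t, ‖x j‖ ^ 2))
        + √(∑ i ∈ s, ‖y i‖ ^ 2) * (‖R‖ * (δ * √(∑ j ∈ t, ‖x j‖ ^ 2))) := by gcongr
    _ = _ := by ring

/-- One vector of norm at most 1 per block reduces the operator-valued block matrix to a scalar one:
the test coefficients are absorbed into these vectors without increasing the norms. -/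
theorem formBound_commutator_blocks {F : Set ℂ} (h : F → C(X, ℂ))
    (hh : ∀ (s : Finset F) z, ∑ j ∈ s, ‖h j z‖ ^ 2 ≤ 1) (g : C(X, ℂ)) {δ : ℝ}
    (hδ : 0 ≤ δ) (hκ : ∀ (j : F) z, h j z ≠ 0 → ‖(j : ℂ) - g z‖ ≤ δ) (R : H →L[ℂ] H)
    (y x : F → H) (hy : ∀ i, ‖y i‖ ≤ 1) (hx : ∀ i, ‖x i‖ ≤ 1) :
    FormBound (fun i j : F => ((i : ℂ) - j) * inner ℂ (π (h i) (y i)) (R (π (h j) (x j))))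
      (‖π g * R - R * π g‖ + 2 * δ * ‖R‖) := by
  intro s t d c
  have hd : √(∑ i ∈ s, ‖star (d i) • y i‖ ^ 2) ≤ √(∑ i ∈ s, ‖d i‖ ^ 2) := by
    gcongr with i
    rw [norm_smul, norm_star]
    exact mul_le_of_le_one_right (norm_nonneg _) (hy i)
  have hc : √(∑ i ∈ t, ‖c i • x i‖ ^ 2) ≤ √(∑ i ∈ t, ‖c i‖ ^ 2) := by
    gcongr with i
    rw [norm_smul]
    exact mul_le_of_le_one_right (norm_nonneg _) (hx i)
  have h1 := norm_sum_commutator_sub_le π h hh (fun j : F => (j : ℂ)) g hδ hκ R s t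
    (fun i => star (d i) • y i) (fun j => c j • x j)
  have h2 : ∑ i ∈ s, ∑ j ∈ t, d i * (((i : ℂ) - j)
        * inner ℂ (π (h i) (y i)) (R (π (h j) (x j)))) * c j
      = ∑ i ∈ s, ∑ j ∈ t, ((i : ℂ) - j)
        * inner ℂ (π (h i) (star (d i) • y i)) (R (π (h j) (c j • x j))) := by
    refine Finset.sum_congr rfl fun i _ => Finset.sum_congr rfl fun j _ => ?_
    simp only [map_smul, inner_smul_left, inner_smul_right]
    simp
    ring
  rw [h2]
  have hvn : ‖∑ i ∈ s, π (h i) (star (d i) • y i)‖ ≤ √(∑ i ∈ s, ‖star (d i) • y i‖ ^ 2) := by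
    simpa using norm_sum_rep_le π s h zero_le_one (by simpa using hh s) fun i => star (d i) • y i
  have hwn : ‖∑ j ∈ t, π (h j) (c j • x j)‖ ≤ √(∑ j ∈ t, ‖c j • x j‖ ^ 2) := by
    simpa using norm_sum_rep_le π t h zero_le_one (by simpa using hh t) fun j => c j • x j
  have h3 : ‖inner ℂ (∑ i ∈ s, π (h i) (star (d i) • y i))
      ((π g * R - R * π g) (∑ j ∈ t, π (h j) (c j • x j)))‖
      ≤ √(∑ i ∈ s, ‖d i‖ ^ 2) * (‖π g * R - R * π g‖ * √(∑ j ∈ t, ‖c j‖ ^ 2)) := by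
    refine (norm_inner_le_norm _ _).trans ?_
    have := hvn.trans hd
    have := ((π g * R - R * π g).le_opNorm (∑ j ∈ t, π (h j) (c j • x j))).trans
      (mul_le_mul_of_nonneg_left (hwn.trans hc) (norm_nonneg _))
    gcongr
  have h4 : 2 * δ * ‖R‖ * √(∑ i ∈ s, ‖star (d i) • y i‖ ^ 2) * √(∑ j ∈ t, ‖c j • x j‖ ^ 2)
      ≤ 2 * δ * ‖R‖ * √(∑ i ∈ s, ‖d i‖ ^ 2) * √(∑ j ∈ t, ‖c j‖ ^ 2) := by gcongr
  have h5 := (norm_le_norm_add_norm_sub' _ _).trans (add_le_add h3 (h1.trans h4))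
  refine h5.trans (le_of_eq ?_)
  ring

/-- The commutator estimate for a representation of `C(X)`, from bounds for Schur
multiplication of matrices with zero diagonal. -/
theorem norm_commutator_le_of_schur {F : Set ℂ} {f : F → ℂ} (lam : C(X, F)) {M : ℝ} (hM : 0 ≤ M)
    (hlip : ∀ s t : F, ‖f s - f t‖ ≤ M * dist s t)
    (hS : ∀ (a : F → F → ℂ) (K : ℝ), 0 < K → FormBound a K → (∀ s, a s s = 0) →
      FormBound (schurMul (dividedDiff f) a) (M * K))
    (ζ G : C(X, ℂ)) (hζ : ∀ z, ζ z = lam z) (hG : ∀ z, G z = f (lam z)) (R : H →L[ℂ] H) :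
    ‖π G * R - R * π G‖ ≤ M * ‖π ζ * R - R * π ζ‖ := by
  have key : ∀ ε : ℝ, 0 < ε → ‖π G * R - R * π G‖
      ≤ M * (‖π ζ * R - R * π ζ‖ + 2 * ε * ‖R‖ + ε) + 2 * (M * ε) * ‖R‖ := by
    intro ε hε
    refine opNorm_le_of_norm_inner_le _ (by positivity) fun x y => ?_
    obtain ⟨t, h, hone, hh, hsupp⟩ := exists_sq_partition lam hε
    have hκ : ∀ (j : F) z, h j z ≠ 0 → ‖(j : ℂ) - ζ z‖ ≤ ε := fun j z hz => by
      rw [hζ, ← dist_eq_norm, dist_comm]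
      exact hsupp j z hz
    have hκ' : ∀ (j : F) z, h j z ≠ 0 → ‖f j - G z‖ ≤ M * ε := fun j z hz => by
      rw [hG, norm_sub_rev]
      exact (hlip _ _).trans (by gcongr; exact hsupp j z hz)
    have hrec : ∀ x : H, ∑ j ∈ t, π (h j) (π (h j) x) = x := fun x => by
      have h1 : π (∑ j ∈ t, h j * h j) x = x := by rw [hone, map_one]; rfl
      rw [map_sum, sum_apply] at h1
      simpa only [map_mul, mul_apply_eq_comp] using h1
    have hcol : ∀ x : H, √(∑ j ∈ t, ‖π (h j) x‖ ^ 2) ≤ ‖x‖ := fun x => by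
      rw [Real.sqrt_le_left (norm_nonneg x)]
      simpa using sum_norm_sq_rep_le π t h (K := 1) (by simpa using hh t) x
    -- The block components of `x` and `y` are split into directions, which enter the matrix, and
    -- lengths, which become the test vectors for the form.
    set a : F → F → ℂ := fun i j => ((i : ℂ) - j) * inner ℂ (π (h i) (direction (π (h i) y)))
      (R (π (h j) (direction (π (h j) x)))) with ha
    have h1 : FormBound a (‖π ζ * R - R * π ζ‖ + 2 * ε * ‖R‖) :=
      formBound_commutator_blocks π h hh ζ hε.le hκ R _ _
        (fun i => norm_direction_le _) (fun i => norm_direction_le _)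
    -- The extra `ε` makes the scale strictly positive.
    have h2 := hS a (‖π ζ * R - R * π ζ‖ + 2 * ε * ‖R‖ + ε) (by positivity)
      (h1.mono (by linarith)) (fun s => by simp [ha])
    have h3 := h2 t t (fun i => (‖π (h i) y‖ : ℂ)) (fun j => (‖π (h j) x‖ : ℂ))
    have h4 := norm_sum_commutator_sub_le π h hh f G (by positivity : 0 ≤ M * ε) hκ' R t t
      (fun i => π (h i) y) (fun j => π (h j) x)
    -- Since `∑ h_j ^ 2 = 1`, the block components reassemble to `y` and `x`.
    rw [hrec, hrec] at h4
    have h5 : ∑ i ∈ t, ∑ j ∈ t, (‖π (h i) y‖ : ℂ) * schurMul (dividedDiff f) a i j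
          * (‖π (h j) x‖ : ℂ)
        = ∑ i ∈ t, ∑ j ∈ t, (f i - f j)
          * inner ℂ (π (h i) (π (h i) y)) (R (π (h j) (π (h j) x))) := by
      refine Finset.sum_congr rfl fun i _ => Finset.sum_congr rfl fun j _ => ?_
      conv_rhs => rw [← norm_smul_direction (π (h i) y), ← norm_smul_direction (π (h j) x)]
      simp only [map_smul, inner_smul_left, inner_smul_right, Complex.conj_ofReal]
      by_cases hij : i = j
      · subst hij; simp [schurMul, dividedDiff]
      · have h0 : (i : ℂ) - j ≠ 0 := fun h0 => hij (Subtype.ext (sub_eq_zero.1 h0))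
        simp only [schurMul, dividedDiff, if_neg hij, ha]
        field_simp
    rw [h5] at h3
    simp only [Complex.norm_real, norm_norm] at h3
    have hx := hcol x
    have hy := hcol y
    have h6 := (norm_le_norm_add_norm_sub _ _).trans (add_le_add h3 h4)
    refine h6.trans ?_
    calc _ ≤ M * (‖π ζ * R - R * π ζ‖ + 2 * ε * ‖R‖ + ε) * ‖y‖ * ‖x‖
          + 2 * (M * ε) * ‖R‖ * ‖y‖ * ‖x‖ := by gcongr
      _ = _ := by ring
  have hlim : Filter.Tendsto (fun ε : ℝ =>
      M * (‖π ζ * R - R * π ζ‖ + 2 * ε * ‖R‖ + ε) + 2 * (M * ε) * ‖R‖)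
      (nhdsWithin 0 (Set.Ioi 0)) (nhds (M * ‖π ζ * R - R * π ζ‖)) := by
    refine tendsto_nhdsWithin_of_tendsto_nhds ?_
    have : Continuous fun ε : ℝ =>
      M * (‖π ζ * R - R * π ζ‖ + 2 * ε * ‖R‖ + ε) + 2 * (M * ε) * ‖R‖ := by fun_prop
    simpa using this.tendsto 0
  exact ge_of_tendsto hlim (eventually_nhdsWithin_of_forall fun ε hε => key ε hε)

end Rep

/-! ### Conclusion. -/

theorem isCLConst_of_schurNormZero_le {F : Set ℂ} {f : F → ℂ} {M : ℝ≥0}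
    (h : schurNormZero (dividedDiff f) ≤ M) : IsCLConst.{u} f M := by
  classical
  rw [schurNormZero_le_iff] at h
  -- A single off-diagonal matrix unit as test matrix shows that `f` is Lipschitz; this gives
  -- continuity and controls the oscillation of `f` on small blocks.
  have hlip : ∀ s t : F, ‖f s - f t‖ ≤ M * dist s t := by
    intro s t
    by_cases hst : s = t
    · simp [hst]
    have hne : (s : ℂ) - t ≠ 0 := fun h0 => hst (Subtype.ext (sub_eq_zero.1 h0))
    have h1 : FormBound (fun i j : F => if i = s ∧ j = t then (1 : ℂ) else 0) 1 := by
      intro s' t' d c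
      have h2 : ∑ i ∈ s', ∑ j ∈ t', d i * (if i = s ∧ j = t then (1 : ℂ) else 0) * c j
          = (if s ∈ s' then d s else 0) * (if t ∈ t' then c t else 0) := by
        simp only [mul_ite, mul_one, mul_zero, ite_mul, zero_mul, ite_and, Finset.sum_ite_eq',
          Finset.sum_ite_irrel, Finset.sum_const_zero]
        split_ifs <;> rfl
      have h3 : ∀ (u : Finset F) (v : F) (e : F → ℂ),
          ‖if v ∈ u then e v else 0‖ ≤ √(∑ i ∈ u, ‖e i‖ ^ 2) := by
        intro u v e
        refine Real.le_sqrt_of_sq_le ?_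
        split_ifs with hv
        · exact Finset.single_le_sum (f := fun i => ‖e i‖ ^ 2) (fun _ _ => sq_nonneg _) hv
        · simpa using Finset.sum_nonneg fun i _ => sq_nonneg ‖e i‖
      rw [h2, norm_mul, one_mul]
      exact mul_le_mul (h3 _ _ _) (h3 _ _ _) (norm_nonneg _) (Real.sqrt_nonneg _)
    have h2 := (h _ h1 fun i j hij => if_neg fun hc =>
      hst (hc.1.symm.trans ((Subtype.ext hij).trans hc.2))).norm_le s t
    simp only [schurMul, dividedDiff, if_neg hst, and_self, if_true, mul_one, norm_div] at h2
    rwa [div_le_iff₀ (norm_pos_iff.2 hne), ← dist_eq_norm (s : ℂ)] at h2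
  have hS : ∀ (a : F → F → ℂ) (K : ℝ), 0 < K → FormBound a K → (∀ s, a s s = 0) →
      FormBound (schurMul (dividedDiff f) a) (M * K) := fun a K hK ha ha0 =>
    ha.schurMul_of_scaled hK fun h1 => h _ h1 fun s t hst => by
      obtain rfl := Subtype.ext hst
      simp [ha0]
  have hf : Continuous f := (LipschitzWith.of_dist_le_mul (K := M) fun s t => by
    rw [dist_eq_norm]; exact hlip s t).continuous
  refine ⟨hf, fun H _ _ _ N R hN hF => ?_⟩
  -- The representation is the functional calculus on `C(spectrum ℂ N, ℂ)`, with `lam` the inclusion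
  -- of the spectrum in `F`.
  have h1 := norm_commutator_le_of_schur (cfcHom hN) (f := f)
    (⟨_, continuous_id.subtype_map hF⟩ : C(spectrum ℂ N, F)) M.2 hlip hS
    ((ContinuousMap.id ℂ).restrict (spectrum ℂ N))
    ((⟨f, hf⟩ : C(F, ℂ)).comp ⟨_, continuous_id.subtype_map hF⟩)
    (fun _ => rfl) (fun _ => rfl) R
  rw [cfcHom_id] at h1
  exact h1

theorem clNorm_eq_schurNormZero {F : Set ℂ} (f : F → ℂ) :
    clNorm.{u} f = schurNormZero (dividedDiff f) := by
  refine le_antisymm ?_ (le_iInf₂ fun C hC => schurNormZero_le_of_isCLConst hC)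
  by_cases htop : schurNormZero (dividedDiff f) = ∞
  · simp [htop]
  lift schurNormZero (dividedDiff f) to ℝ≥0 using htop with M hM
  exact iInf₂_le M (isCLConst_of_schurNormZero_le hM.ge)

theorem isCommutatorLipschitz_iff {F : Set ℂ} {f : F → ℂ} :
    IsCommutatorLipschitz.{u} f ↔ clNorm.{u} f < ∞ := by
  simp only [IsCommutatorLipschitz, clNorm, iInf_lt_iff, ENNReal.coe_lt_top, exists_prop, and_true]

end CommutatorLipschitz

end

theorem mainTheorem5 (F : Set ℂ) (hF : IsClosed F) (hne : F.Nonempty) (f : F → ℂ) :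
    (CommutatorLipschitz.IsCommutatorLipschitz.{u} f ↔
      CommutatorLipschitz.IsSchurMultiplier (CommutatorLipschitz.dividedDiff f)) ∧
    CommutatorLipschitz.clNorm.{u} f =
      CommutatorLipschitz.schurNormZero (CommutatorLipschitz.dividedDiff f) ∧
    CommutatorLipschitz.schurNormZero (CommutatorLipschitz.dividedDiff f) ≤
      CommutatorLipschitz.schurNorm (CommutatorLipschitz.dividedDiff f) ∧
    CommutatorLipschitz.schurNorm (CommutatorLipschitz.dividedDiff f) ≤
      2 * CommutatorLipschitz.clNorm.{u} f := by
  have h1 := CommutatorLipschitz.clNorm_eq_schurNormZero.{u} f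
  have h2 := CommutatorLipschitz.schurNormZero_le_schurNorm (CommutatorLipschitz.dividedDiff f)
  have h3 := CommutatorLipschitz.schurNorm_le_two_mul_schurNormZero
    (Φ := CommutatorLipschitz.dividedDiff f) fun s => by simp [CommutatorLipschitz.dividedDiff]
  refine ⟨?_, h1, h2, h1 ▸ h3⟩
  rw [CommutatorLipschitz.isCommutatorLipschitz_iff, CommutatorLipschitz.isSchurMultiplier_iff, h1]
  exact ⟨fun h => h3.trans_lt (ENNReal.mul_lt_top ENNReal.ofNat_lt_top h), fun h => h2.trans_lt h⟩
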